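/- Let $S$ be a finite alphabet, let $A$ be a transition relation on $S$, and let $\Sigma=\{\omega\in S^{\mathbb N_0}:\ (\omega_i,\omega_{i+1})\in A\ \forall i\ge 0\}$ be the associated one-sided compact topological Markov shift, with the metric $d(\omega,\omega')=2^{-\min\{i:\ \omega_i\neq\omega'_i\}}$ for $\omega\ne\omega'$ and the left shift $T:\Sigma\to\Sigma$. Let $X$ be a non-empty compact metric space, and let $(F_\omega)_{\omega\in\Sigma}$ be a family of homeomorphisms of $X$ such that * for some $\alpha>0$ every $F_\omega$ is $\alpha$-Hölder, and * $\omega\mapsto F_\omega$ is Hölder continuous for the uniform distance: there are $C,\beta>0$ with $d(F_\omega(t),F_{\omega'}(t))\le C\,d(\omega,\omega')^{\beta}$ for all $\omega,\omega'\in\Sigma$, $t\in X$. Let $\{\phi_t\}_{t\in X}$ be an equi-Hölder family of potentials $\phi_t:\Sigma\to\mathbb R$, that is, for some exponent $\beta'>0$ the $\beta'$-Hölder norms of the $\phi_t$ are bounded uniformly in $t$, and suppose that $t\mapsto\phi_t(\omega)$ is continuous for every $\omega\in\Sigma$. Put $F^k_\omega:=F_{T^{k-1}\omega}\circ\cdots\circ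 F_\omega$, $\widehat F(\omega,t):=(T\omega,F_\omega(t))$ and $\widehat\phi(\omega,t):=\phi_t(\omega)$. Fix a letter $a$ and a point $\omega_a\in\Sigma$ whose first letter is $a$. For an admissible word $\underline w=w_0\dots w_{n-1}$ with $w_{n-1}=a$ let $\underline w\omega_a\in\Sigma$ be the sequence obtained by gluing $\underline w$ and $\omega_a$ along the common letter $a$, so that $T^{n-1}(\underline w\omega_a)=\omega_a$. The pressure out of equilibrium is $$\check P(\{\phi_t\}_{t\in X}):=\limsup_{n\to\infty}\frac1n\log\sup_{t\in X}\check Z_n(\phi_t,a),\qquad \check Z_n(\phi_t,a):=\sum_{|\underline w|=n,\ w_{n-1}=a}\exp\Big(\sum_{k=0}^{n-1}\phi_{F^k_{\underline w\omega_a}(t)}\big(T^k(\underline w\omega_a)\big)\Big)$$ (with $\log 0=-\infty$), and the maximal asymptotic instability potential is $$\widetilde\phi(\omega):=\limsup_{n\to\infty}\ \sup_{t\in X}\ \frac1n\sum_{k=0}^{n-1}\widehat\phi\big(\widehat F^k(\omega,t)\big).$$ Then $\widetilde\phi$ is integrable with respect to every ergodic $T$-invariant Borel probability measure on $\Sigma$,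 and for every choice of $a$ and $\omega_a$ $$\check P(\{\phi_t\}_{t\in X})\ \le\ \sup_{\nu}\Big\{h_\nu(T)+\int_\Sigma\widetilde\phi\,d\nu\Big\},$$ where the supremum is over all ergodic $T$-invariant Borel probability measures $\nu$ on $\Sigma$ and $h_\nu(T)$ is the Kolmogorov–Sinai entropy. -/

import Mathlib

open MeasureTheory Filter
open scoped NNReal ENNReal

noncomputable section

namespace POE

/-- The one-sided topological Markov shift with alphabet `S` and transition relation `A`:
all sequences `ω₀ ω₁ ω₂ …` of letters with `A ωᵢ ωᵢ₊₁` for every `i`. -/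
@[ext]
structure MarkovShift {S : Type*} (A : S → S → Prop) where
  /-- the sequence of letters -/
  seq : ℕ → S
  /-- every transition is admissible -/
  adm : ∀ i, A (seq i) (seq (i + 1))

namespace MarkovShift

variable {S : Type*} {A : S → S → Prop}

theorem seq_injective : Function.Injective (seq : MarkovShift A → ℕ → S) :=
  fun _ _ h => MarkovShift.ext h

/-- The standard metric: `dist ω ω' = 2⁻ⁿ`, with `n` the first index at which `ω` and `ω'` differ.
It induces the topology of pointwise convergence (with discrete `S`). -/
instance : MetricSpace (MarkovShift A) :=
  letI : TopologicalSpace S := ⊥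
  haveI : DiscreteTopology S := ⟨rfl⟩
  MetricSpace.induced seq seq_injective PiNat.metricSpace

instance : MeasurableSpace (MarkovShift A) := borel _

instance : BorelSpace (MarkovShift A) := ⟨rfl⟩

/-- The left shift `T`. -/
def shift (ω : MarkovShift A) : MarkovShift A where
  seq i := ω.seq (i + 1)
  adm i := ω.adm (i + 1)

/-- The admissible words `w = w₀ … wₙ₋₁` of length `n` whose last letter `wₙ₋₁` is `a`. -/
def WordTo (A : S → S → Prop) (n : ℕ) (a : S) : Type _ :=
  {w : Fin n → S //
    (∀ i j : Fin n, (j : ℕ) = i + 1 → A (w i) (w j)) ∧ ∀ i : Fin n, (i : ℕ) + 1 = n → w i = a}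

instance [Finite S] (n : ℕ) (a : S) : Finite (WordTo A n a) :=
  inferInstanceAs (Finite (Subtype _))

instance [Finite S] (n : ℕ) (a : S) : Fintype (WordTo A n a) := Fintype.ofFinite _

/-- The point `w ω` obtained by gluing a word `w` of length `n` that ends in the letter `a` to a
point `ω = (a, ω₁, ω₂, …)` of the cylinder `[a]` along the common letter `a`:
the sequence `w₀, …, wₙ₋₂, a, ω₁, ω₂, …`. -/
def glue {n : ℕ} (ω : MarkovShift A) (w : WordTo A n (ω.seq 0)) : MarkovShift A where
  seq i := if h : i < n then w.1 ⟨i, h⟩ else ω.seq (i + 1 - n)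
  adm i := by
    by_cases h : i + 1 < n
    · have h' : i < n := by omega
      simp only [h, h', dif_pos]
      exact w.2.1 _ _ rfl
    · by_cases h' : i < n
      · have hn : i + 1 = n := by omega
        have e : w.1 ⟨i, h'⟩ = ω.seq 0 := w.2.2 ⟨i, h'⟩ hn
        have e2 : i + 1 + 1 - n = 0 + 1 := by omega
        simp only [h, h', dif_pos, dif_neg, not_false_eq_true, e, e2]
        exact ω.adm 0
      · have e2 : i + 1 + 1 - n = i + 1 - n + 1 := by omega
        simp only [h, h', dif_neg, not_false_eq_true, e2]
        exact ω.adm _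

end MarkovShift

section Entropy

variable {Ω : Type*} [MeasurableSpace Ω]

/-- The Shannon entropy `H_ν(q) = -∑ᵢ ν(q⁻¹{i}) log ν(q⁻¹{i})` of the finite partition
`{q⁻¹{i}}` given by a labelling `q : Ω → ι`. -/
def partitionEntropy {ι : Type*} [Fintype ι] (ν : Measure Ω) (q : Ω → ι) : ℝ :=
  ∑ i, Real.negMulLog (ν.real (q ⁻¹' {i}))

/-- The Kolmogorov–Sinai entropy `h_ν(T)`: the supremum over all finite measurable partitions
`p : Ω → Fin k` of `lim (1/n) H_ν(p ∨ T⁻¹p ∨ … ∨ T⁻⁽ⁿ⁻¹⁾p)`. -/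
def ksEntropy (T : Ω → Ω) (ν : Measure Ω) : EReal :=
  ⨆ (k : ℕ) (p : Ω → Fin k) (_ : Measurable p),
    limsup (fun n : ℕ =>
      ((partitionEntropy ν (fun ω (j : Fin n) => p (T^[j] ω)) / n : ℝ) : EReal)) atTop

end Entropy

variable {S : Type*} {A : S → S → Prop} {X : Type*}

/-- `F^k_ω = F_{T^{k-1}ω} ∘ ⋯ ∘ F_ω`. -/
def fiberIter (F : MarkovShift A → X → X) : ℕ → MarkovShift A → X → X
  | 0, _, t => t
  | k + 1, ω, t => F (MarkovShift.shift^[k] ω) (fiberIter F k ω t)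

/-- The skew product `F̂(ω, t) = (Tω, F_ω(t))`. -/
def skewProduct (F : MarkovShift A → X → X) (p : MarkovShift A × X) : MarkovShift A × X :=
  (p.1.shift, F p.1 p.2)

/-- `φ̂(ω, t) = φ_t(ω)`. -/
def jointPotential (φ : X → MarkovShift A → ℝ) (p : MarkovShift A × X) : ℝ :=
  φ p.2 p.1

/-- `Ž_n(φ_t, a) = ∑_{|w| = n, w_{n-1} = a} exp (∑_{k<n} φ_{F^k_{w ω_a}(t)} (T^k (w ω_a)))`,
with `a` the first letter of `ω_a`. -/
def partitionSum [Finite S] (F : MarkovShift A → X → X) (φ : X → MarkovShift A → ℝ)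
    (ωa : MarkovShift A) (n : ℕ) (t : X) : ℝ :=
  ∑ w : MarkovShift.WordTo A n (ωa.seq 0),
    Real.exp (∑ k ∈ Finset.range n,
      φ (fiberIter F k (ωa.glue w) t) (MarkovShift.shift^[k] (ωa.glue w)))

/-- The pressure out of equilibrium `limsup (1/n) log sup_t Ž_n(φ_t, a)`, computed with the
base point `ω_a ∈ [a]`; here `log 0 = -∞`. -/
def pressure [Finite S] (F : MarkovShift A → X → X) (φ : X → MarkovShift A → ℝ)
    (ωa : MarkovShift A) : EReal :=
  limsup (fun n : ℕ =>
    ENNReal.log (⨆ t : X, ENNReal.ofReal (partitionSum F φ ωa n t)) / (n : EReal)) atTop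

/-- The maximal asymptotic instability potential
`φ̃(ω) = limsup_n sup_t (1/n) ∑_{k<n} φ̂(F̂^k(ω, t))`. -/
def maxInstability (F : MarkovShift A → X → X) (φ : X → MarkovShift A → ℝ)
    (ω : MarkovShift A) : ℝ :=
  limsup (fun n : ℕ =>
    ⨆ t : X, (1 / (n : ℝ)) *
      ∑ k ∈ Finset.range n, jointPotential φ ((skewProduct F)^[k] (ω, t))) atTop

end POE

end

/-!
Write `Φₙ(ω)` for the maximum over `t` of the `n`-th Birkhoff sum of `φ̂` at `(ω, t)`. It is a
continuous subadditive cocycle over `T`, it satisfies `Žₙ(φ_t, a) ≤ ∑_w exp Φₙ(w ω_a)`, and `φ̃` is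
the upper limit of `Φₙ / n`.

The logarithm of `∑_w exp Φₙ(w ω_a)` is the free energy (entropy of the partition into `n`-words
plus integral of `Φₙ`) of the Gibbs measure on the points `w ω_a`. As in Misiurewicz's proof of the
variational principle, averaging these Gibbs measures along orbits and passing to a limit gives an
invariant measure whose free energy per unit time is at least the pressure. On invariant measures
that quantity is upper semicontinuous (an infimum of continuous functions) and convex (a limit of
almost affine ones), so by Krein–Milman it attains its maximum at an ergodic measure `ν`. Finally
the reverse Fatou lemma bounds `lim (1/n) ∫ Φₙ dν` by `∫ φ̃ dν`.
-/

namespace POE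

open scoped Topology

section Gibbs

open Real

theorem negMulLog_le_neg_mul_log_add_sub {p r : ℝ} (hp : 0 ≤ p) (hr : 0 ≤ r)
    (hpr : r = 0 → p = 0) : negMulLog p ≤ -(p * log r) + (r - p) := by
  rcases hp.eq_or_lt with rfl | hp
  · simpa using hr
  have hr : 0 < r := hr.lt_of_ne fun h => hp.ne' (hpr h.symm)
  have hlog : p * log (r / p) ≤ p * (r / p - 1) :=
    mul_le_mul_of_nonneg_left (log_le_sub_one_of_pos (by positivity)) hp.le
  rw [log_div hr.ne' hp.ne', mul_sub_one, mul_div_cancel₀ r hp.ne'] at hlog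
  rw [negMulLog]
  linarith

theorem sum_negMulLog_le_neg_sum_mul_log {ι : Type*} {s : Finset ι} {P R : ι → ℝ}
    (hP : ∀ i ∈ s, 0 ≤ P i) (hR : ∀ i ∈ s, 0 ≤ R i) (hPR : ∀ i ∈ s, R i = 0 → P i = 0)
    (hsum : ∑ i ∈ s, R i ≤ ∑ i ∈ s, P i) :
    ∑ i ∈ s, negMulLog (P i) ≤ -∑ i ∈ s, P i * log (R i) := by
  have h := Finset.sum_le_sum fun i hi =>
    negMulLog_le_neg_mul_log_add_sub (hP i hi) (hR i hi) (hPR i hi)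
  rw [Finset.sum_add_distrib, Finset.sum_neg_distrib, Finset.sum_sub_distrib] at h
  linarith

theorem negMulLog_add_le {u v : ℝ} (hu : 0 ≤ u) (hv : 0 ≤ v) :
    negMulLog (u + v) ≤ negMulLog u + negMulLog v := by
  rcases hu.eq_or_lt with rfl | hu
  · simp
  rcases hv.eq_or_lt with rfl | hv
  · simp
  have hlog_u : u * log u ≤ u * log (u + v) := by gcongr; linarith
  have hlog_v : v * log v ≤ v * log (u + v) := by gcongr; linarith
  simp only [negMulLog]
  linarith

end Gibbs

section Entropy

variable {Ω ι κ : Type*} [MeasurableSpace Ω] [Fintype ι] [Fintype κ]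

theorem partitionEntropy_nonneg (ν : Measure Ω) [IsProbabilityMeasure ν] (q : Ω → ι) :
    0 ≤ partitionEntropy ν q :=
  Finset.sum_nonneg fun _ _ => Real.negMulLog_nonneg measureReal_nonneg measureReal_le_one

theorem partitionEntropy_comp_equiv (ν : Measure Ω) (q : Ω → ι) (e : ι ≃ κ) :
    partitionEntropy ν (e ∘ q) = partitionEntropy ν q := by
  rw [partitionEntropy, partitionEntropy, ← e.sum_comp]
  refine Finset.sum_congr rfl fun i _ => ?_
  rw [Set.preimage_comp, ← Set.image_singleton, e.preimage_image]

theorem partitionEntropy_of_injective [Fintype Ω] (ν : Measure Ω) {q : Ω → ι}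
    (hq : Function.Injective q) :
    partitionEntropy ν q = ∑ ω, Real.negMulLog (ν.real {ω}) := by
  refine (Finset.sum_of_injOn q hq.injOn (by simp) (fun i _ hi => ?_) fun ω _ => ?_).symm
  · have hempty : q ⁻¹' {i} = ∅ := Set.preimage_singleton_eq_empty.2 (by simpa using hi)
    simp [hempty]
  · rw [← Set.image_singleton, hq.preimage_image]

theorem sum_mul_partitionEntropy_le {J : Type*} (s : Finset J) {c : J → ℝ≥0}
    (hc : ∑ j ∈ s, c j = 1) (μ : J → Measure Ω) [∀ j, IsFiniteMeasure (μ j)] (q : Ω → ι) :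
    ∑ j ∈ s, c j * partitionEntropy (μ j) q ≤ partitionEntropy (∑ j ∈ s, c j • μ j) q := by
  simp only [partitionEntropy, Finset.mul_sum]
  rw [Finset.sum_comm]
  refine Finset.sum_le_sum fun i _ => ?_
  have hmix : (∑ j ∈ s, c j • μ j).real (q ⁻¹' {i}) =
      ∑ j ∈ s, (c j : ℝ) * (μ j).real (q ⁻¹' {i}) := by
    rw [measureReal_def, Measure.finsetSum_apply, ENNReal.toReal_sum fun j _ => by finiteness]
    exact Finset.sum_congr rfl fun j _ => measureReal_nnreal_smul_apply (c j)
  rw [hmix]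
  exact Real.concaveOn_negMulLog.le_map_sum (fun j _ => (c j).2) (by exact_mod_cast hc)
    fun j _ => measureReal_nonneg

variable [MeasurableSpace ι] [MeasurableSingletonClass ι]

theorem partitionEntropy_map {Ω' : Type*} [MeasurableSpace Ω'] (ν : Measure Ω) {f : Ω → Ω'}
    (hf : Measurable f) {q : Ω' → ι} (hq : Measurable q) :
    partitionEntropy (ν.map f) q = partitionEntropy ν (q ∘ f) := by
  refine Finset.sum_congr rfl fun i _ => ?_
  rw [map_measureReal_apply hf (hq (measurableSet_singleton i)), Set.preimage_comp]

theorem sum_measureReal_preimage_mul (ν : Measure Ω) [IsFiniteMeasure ν] {q : Ω → ι}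
    (hq : Measurable q) (f : ι → ℝ) :
    ∑ i, ν.real (q ⁻¹' {i}) * f i = ∫ ω, f (q ω) ∂ν := by
  rw [← integral_map hq.aemeasurable (by fun_prop), integral_fintype .of_finite]
  simp only [map_measureReal_apply hq (measurableSet_singleton _), smul_eq_mul]

theorem sum_measureReal_preimage (ν : Measure Ω) [IsProbabilityMeasure ν] {q : Ω → ι}
    (hq : Measurable q) : ∑ i, ν.real (q ⁻¹' {i}) = 1 := by
  simpa using sum_measureReal_preimage_mul ν hq 1

theorem partitionEntropy_le_neg_sum_mul_log (ν : Measure Ω) [IsProbabilityMeasure ν] {q : Ω → ι}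
    (hq : Measurable q) {R : ι → ℝ} (hR : ∀ i, 0 ≤ R i) (hR1 : ∑ i, R i ≤ 1)
    (hνR : ∀ i, R i = 0 → ν.real (q ⁻¹' {i}) = 0) :
    partitionEntropy ν q ≤ -∑ i, ν.real (q ⁻¹' {i}) * Real.log (R i) :=
  sum_negMulLog_le_neg_sum_mul_log (fun _ _ => measureReal_nonneg) (fun i _ => hR i)
    (fun i _ => hνR i) (hR1.trans_eq (sum_measureReal_preimage ν hq).symm)

theorem partitionEntropy_le_log_card (ν : Measure Ω) [IsProbabilityMeasure ν] {q : Ω → ι}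
    (hq : Measurable q) : partitionEntropy ν q ≤ Real.log (Fintype.card ι) := by
  have : Nonempty ι := (nonempty_of_isProbabilityMeasure ν).map q
  have hcard : (Fintype.card ι : ℝ) ≠ 0 := by exact_mod_cast Fintype.card_ne_zero
  have h := partitionEntropy_le_neg_sum_mul_log ν hq (R := fun _ => (Fintype.card ι : ℝ)⁻¹)
    (fun _ => by positivity) (by simp [hcard]) fun _ h0 => absurd h0 (inv_ne_zero hcard)
  rwa [← Finset.sum_mul, sum_measureReal_preimage ν hq, one_mul, Real.log_inv, neg_neg] at h

theorem partitionEntropy_prodMk_le [MeasurableSpace κ] [MeasurableSingletonClass κ]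
    (ν : Measure Ω) [IsProbabilityMeasure ν] {q : Ω → ι} {r : Ω → κ} (hq : Measurable q)
    (hr : Measurable r) :
    partitionEntropy ν (fun ω => (q ω, r ω)) ≤ partitionEntropy ν q + partitionEntropy ν r := by
  let P (i : ι) : ℝ := ν.real (q ⁻¹' {i})
  let R (j : κ) : ℝ := ν.real (r ⁻¹' {j})
  let Q (x : ι × κ) : ℝ := ν.real ((fun ω => (q ω, r ω)) ⁻¹' {x})
  have hQP : ∀ x, P x.1 = 0 → Q x = 0 := fun x h =>
    measureReal_mono_null (s₂ := q ⁻¹' {x.1}) (fun ω hω => congrArg Prod.fst hω) h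
  have hQR : ∀ x, R x.2 = 0 → Q x = 0 := fun x h =>
    measureReal_mono_null (s₂ := r ⁻¹' {x.2}) (fun ω hω => congrArg Prod.snd hω) h
  have hlog : ∀ x, Q x * Real.log (P x.1 * R x.2) =
      Q x * Real.log (P x.1) + Q x * Real.log (R x.2) := by
    intro x
    by_cases hx : Q x = 0
    · simp [hx]
    · rw [Real.log_mul (mt (hQP x) hx) (mt (hQR x) hx), mul_add]
  have hfst : ∑ x, Q x * Real.log (P x.1) = ∑ i, P i * Real.log (P i) :=
    (sum_measureReal_preimage_mul ν (hq.prodMk hr) fun x => Real.log (P x.1)).trans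
      (sum_measureReal_preimage_mul ν hq fun i => Real.log (P i)).symm
  have hsnd : ∑ x, Q x * Real.log (R x.2) = ∑ j, R j * Real.log (R j) :=
    (sum_measureReal_preimage_mul ν (hq.prodMk hr) fun x => Real.log (R x.2)).trans
      (sum_measureReal_preimage_mul ν hr fun j => Real.log (R j)).symm
  calc partitionEntropy ν (fun ω => (q ω, r ω))
      ≤ -∑ x, Q x * Real.log (P x.1 * R x.2) :=
        partitionEntropy_le_neg_sum_mul_log ν (hq.prodMk hr)
          (fun x => mul_nonneg measureReal_nonneg measureReal_nonneg)
          (by rw [Fintype.sum_prod_type, ← Finset.sum_mul_sum, sum_measureReal_preimage ν hq,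
            sum_measureReal_preimage ν hr, one_mul])
          fun x hx => (mul_eq_zero.1 hx).elim (hQP x) (hQR x)
    _ = partitionEntropy ν q + partitionEntropy ν r := by
        simp only [hlog, Finset.sum_add_distrib, hfst, hsnd, neg_add, ← Finset.sum_neg_distrib,
          partitionEntropy, Real.negMulLog, neg_mul, P, R]

theorem partitionEntropy_add_le (a b : ℝ≥0) (μ₁ μ₂ : Measure Ω) [IsProbabilityMeasure μ₁]
    [IsProbabilityMeasure μ₂] {q : Ω → ι} (hq : Measurable q) :
    partitionEntropy (a • μ₁ + b • μ₂) q ≤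
      a * partitionEntropy μ₁ q + b * partitionEntropy μ₂ q +
        (Real.negMulLog a + Real.negMulLog b) := by
  have hatom : ∀ i, Real.negMulLog ((a • μ₁ + b • μ₂).real (q ⁻¹' {i})) ≤
      (μ₁.real (q ⁻¹' {i}) * Real.negMulLog a + a * Real.negMulLog (μ₁.real (q ⁻¹' {i}))) +
        (μ₂.real (q ⁻¹' {i}) * Real.negMulLog b + b * Real.negMulLog (μ₂.real (q ⁻¹' {i}))) := by
    intro i
    rw [measureReal_add_apply, measureReal_nnreal_smul_apply, measureReal_nnreal_smul_apply,
      ← Real.negMulLog_mul, ← Real.negMulLog_mul]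
    exact negMulLog_add_le (mul_nonneg a.2 measureReal_nonneg) (mul_nonneg b.2 measureReal_nonneg)
  refine (Finset.sum_le_sum fun i _ => hatom i).trans_eq ?_
  simp only [Finset.sum_add_distrib, ← Finset.sum_mul, ← Finset.mul_sum,
    sum_measureReal_preimage _ hq, partitionEntropy]
  ring

end Entropy

section ReverseFatou

theorem tendsto_iSup_nat_add_limsup {R : Type*} [ConditionallyCompleteLinearOrder R]
    [TopologicalSpace R] [InfConvergenceClass R] {u : ℕ → R} (hu : BddAbove (Set.range u))
    (hu' : BddBelow (Set.range u)) :
    Tendsto (fun n => ⨆ k, u (n + k)) atTop (𝓝 (limsup u atTop)) := by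
  have hu_tail : ∀ n, BddAbove (Set.range fun k => u (n + k)) := fun n =>
    hu.mono (Set.range_comp_subset_range (n + ·) u)
  have hanti : Antitone fun n => ⨆ k, u (n + k) := antitone_nat_of_succ_le fun n =>
    ciSup_le fun k => (congrArg u (by ring)).trans_le (le_ciSup (hu_tail n) (k + 1))
  have hbdd : BddBelow (Set.range fun n => ⨆ k, u (n + k)) := by
    obtain ⟨b, hb⟩ := hu'
    exact ⟨b, Set.forall_mem_range.2 fun n => (hb ⟨n, rfl⟩).trans (le_ciSup (hu_tail n) 0)⟩
  have hlimsup : limsup u atTop = ⨅ n, ⨆ k, u (n + k) := by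
    refine le_antisymm (le_ciInf fun n => ?_) (le_csInf ?_ fun a ha => ?_)
    · refine limsup_le_of_le hu'.isBoundedUnder_of_range.isCoboundedUnder_le ?_
      filter_upwards [eventually_ge_atTop n] with m hm
      simpa only [Nat.add_sub_cancel' hm] using le_ciSup (hu_tail n) (m - n)
    · obtain ⟨b, hb⟩ := hu
      exact ⟨b, Eventually.of_forall fun n => hb ⟨n, rfl⟩⟩
    · obtain ⟨n, hn⟩ := eventually_atTop.1 ha
      exact ciInf_le_of_le hbdd n (ciSup_le fun k => hn _ le_self_add)
  exact hlimsup ▸ tendsto_atTop_ciInf hanti hbdd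

theorem abs_iSup_le {ι : Type*} [Nonempty ι] {u : ι → ℝ} {B : ℝ} (hu : ∀ i, |u i| ≤ B) :
    |⨆ i, u i| ≤ B := by
  have hbdd : BddAbove (Set.range u) :=
    ⟨B, Set.forall_mem_range.2 fun i => (abs_le.1 (hu i)).2⟩
  obtain ⟨i⟩ := ‹Nonempty ι›
  exact abs_le.2 ⟨(abs_le.1 (hu i)).1.trans (le_ciSup hbdd i),
    ciSup_le fun i => (abs_le.1 (hu i)).2⟩

variable {Ω : Type*} [MeasurableSpace Ω] {μ : Measure Ω} {f : ℕ → Ω → ℝ} {g : Ω → ℝ}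

theorem tendsto_iSup_nat_add_limsup_of_abs_le {u : ℕ → ℝ} {B : ℝ} (hu : ∀ n, |u n| ≤ B) :
    Tendsto (fun n => ⨆ k, u (n + k)) atTop (𝓝 (limsup u atTop)) :=
  tendsto_iSup_nat_add_limsup ⟨B, Set.forall_mem_range.2 fun n => (abs_le.1 (hu n)).2⟩
    ⟨-B, Set.forall_mem_range.2 fun n => (abs_le.1 (hu n)).1⟩

theorem integrable_limsup (hf : ∀ n, Measurable (f n)) (hg : Integrable g μ)
    (hfg : ∀ n ω, |f n ω| ≤ g ω) :
    Integrable (fun ω => limsup (fun n => f n ω) atTop) μ :=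
  hg.mono' (Measurable.limsup hf).aestronglyMeasurable <| ae_of_all _ fun ω =>
    le_of_tendsto' (tendsto_iSup_nat_add_limsup_of_abs_le (hfg · ω)).abs fun _ =>
      abs_iSup_le fun _ => hfg _ ω

theorem tendsto_integral_iSup_nat_add (hf : ∀ n, Measurable (f n)) (hg : Integrable g μ)
    (hfg : ∀ n ω, |f n ω| ≤ g ω) :
    Tendsto (fun n => ∫ ω, ⨆ k, f (n + k) ω ∂μ) atTop
      (𝓝 (∫ ω, limsup (fun n => f n ω) atTop ∂μ)) :=
  tendsto_integral_of_dominated_convergence g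
    (fun n => (Measurable.iSup fun k => hf (n + k)).aestronglyMeasurable) hg
    (fun _ => ae_of_all _ fun ω => abs_iSup_le fun _ => hfg _ ω)
    (ae_of_all _ fun ω => tendsto_iSup_nat_add_limsup_of_abs_le (hfg · ω))

theorem integral_le_integral_iSup_nat_add (hf : ∀ n, Measurable (f n)) (hg : Integrable g μ)
    (hfg : ∀ n ω, |f n ω| ≤ g ω) (n : ℕ) :
    ∫ ω, f n ω ∂μ ≤ ∫ ω, ⨆ k, f (n + k) ω ∂μ := by
  refine integral_mono (hg.mono' (hf n).aestronglyMeasurable (ae_of_all _ (hfg n)))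
    (hg.mono' (Measurable.iSup fun k => hf (n + k)).aestronglyMeasurable
      (ae_of_all _ fun ω => abs_iSup_le fun _ => hfg _ ω)) fun ω => ?_
  have hbdd : BddAbove (Set.range fun k => f (n + k) ω) :=
    ⟨g ω, Set.forall_mem_range.2 fun k => (abs_le.1 (hfg (n + k) ω)).2⟩
  exact le_ciSup hbdd 0

end ReverseFatou

section Itinerary

variable {Ω ι : Type*}

/-- The labels `p ω, p (T ω), …, p (Tⁿ⁻¹ ω)` of an orbit segment. As a labelling of `Ω` it encodes
the refined partition `p ∨ T⁻¹p ∨ … ∨ T⁻⁽ⁿ⁻¹⁾p`. -/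
def itinerary (T : Ω → Ω) (p : Ω → ι) (n : ℕ) (ω : Ω) : Fin n → ι :=
  fun j => p (T^[j] ω)

variable {T : Ω → Ω} {p : Ω → ι}

theorem isLocallyConstant_itinerary [TopologicalSpace Ω] (hT : Continuous T)
    (hp : IsLocallyConstant p) (n : ℕ) : IsLocallyConstant (itinerary T p n) := by
  let : TopologicalSpace ι := ⊥
  have : DiscreteTopology ι := ⟨rfl⟩
  exact (IsLocallyConstant.iff_continuous _).2
    (continuous_pi fun j => (hp.comp_continuous (hT.iterate j)).continuous)

variable [MeasurableSpace Ω] [MeasurableSpace ι]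

theorem measurable_itinerary (hT : Measurable T) (hp : Measurable p) (n : ℕ) :
    Measurable (itinerary T p n) :=
  measurable_pi_lambda _ fun j => hp.comp (hT.iterate j)

variable [Fintype ι] [MeasurableSingletonClass ι]

theorem partitionEntropy_itinerary_add_le (hT : Measurable T) (hp : Measurable p) (μ : Measure Ω)
    [IsProbabilityMeasure μ] (m n : ℕ) :
    partitionEntropy μ (itinerary T p (m + n)) ≤
      partitionEntropy μ (itinerary T p m) +
        partitionEntropy (μ.map T^[m]) (itinerary T p n) := by
  have hm := measurable_itinerary hT hp m
  have hn := measurable_itinerary hT hp n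
  have hsplit : itinerary T p (m + n) =
      Fin.appendEquiv m n ∘ fun ω => (itinerary T p m ω, itinerary T p n (T^[m] ω)) := by
    funext ω j
    refine Fin.addCases (fun i => ?_) (fun i => ?_) j
    · simp [Fin.appendEquiv, itinerary]
    · simp [Fin.appendEquiv, itinerary, ← Function.iterate_add_apply, add_comm]
  rw [hsplit, partitionEntropy_comp_equiv, partitionEntropy_map μ (hT.iterate m) hn]
  exact partitionEntropy_prodMk_le μ hm (hn.comp (hT.iterate m))

theorem partitionEntropy_itinerary_le (hT : Measurable T) (hp : Measurable p) (μ : Measure Ω)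
    [IsProbabilityMeasure μ] (n : ℕ) :
    partitionEntropy μ (itinerary T p n) ≤ Real.log (Fintype.card ι) * n := by
  refine (partitionEntropy_le_log_card μ (measurable_itinerary hT hp n)).trans_eq ?_
  simp [mul_comm]

theorem limsup_partitionEntropy_itinerary_div_le_ksEntropy (hp : Measurable p) (ν : Measure Ω) :
    limsup (fun n : ℕ => ((partitionEntropy ν (itinerary T p n) / n : ℝ) : EReal)) atTop ≤
      ksEntropy T ν := by
  let e := Fintype.equivFin ι
  have hrelabel : ∀ n, partitionEntropy ν (itinerary T p n) =
      partitionEntropy ν (itinerary T (e ∘ p) n) := fun n =>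
    (partitionEntropy_comp_equiv ν (itinerary T p n) (Equiv.piCongrRight fun _ => e)).symm
  simp only [hrelabel]
  exact le_iSup_of_le _ (le_iSup_of_le (e ∘ p)
    (le_iSup_of_le (Measurable.of_discrete.comp hp) le_rfl))

end Itinerary

section FreeEnergy

variable {Ω ι : Type*}

/-- A continuous subadditive cocycle `Φ` over `T`, growing at most linearly with slope `C`. -/
structure IsSubadditiveCocycle [TopologicalSpace Ω] (T : Ω → Ω) (Φ : ℕ → Ω → ℝ) (C : ℝ) :
    Prop where
  continuous : ∀ n, Continuous (Φ n)
  add_le : ∀ m n ω, Φ (m + n) ω ≤ Φ m ω + Φ n (T^[m] ω)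
  abs_le : ∀ n ω, |Φ n ω| ≤ C * n

/-- The free energy `H_μ(p ∨ T⁻¹p ∨ … ∨ T⁻⁽ⁿ⁻¹⁾p) + ∫ Φₙ dμ` of an orbit segment of length `n`. -/
noncomputable def freeEnergy [MeasurableSpace Ω] [Fintype ι] (T : Ω → Ω) (p : Ω → ι)
    (Φ : ℕ → Ω → ℝ) (n : ℕ) (μ : Measure Ω) : ℝ :=
  partitionEntropy μ (itinerary T p n) + ∫ ω, Φ n ω ∂μ

/-- The infimum of the free energies per unit time; for an invariant measure it is also their
limit. The infimum runs over `n ≥ 1` because the term at `n = 0` is the junk value `0 / 0`. -/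
noncomputable def asymptoticFreeEnergy [MeasurableSpace Ω] [Fintype ι] (T : Ω → Ω) (p : Ω → ι)
    (Φ : ℕ → Ω → ℝ) (μ : Measure Ω) : ℝ :=
  ⨅ n : Set.Ici 1, freeEnergy T p Φ n μ / (n : ℕ)

namespace IsSubadditiveCocycle

variable [TopologicalSpace Ω] {T : Ω → Ω} {Φ : ℕ → Ω → ℝ} {C : ℝ}

theorem nonneg [Nonempty Ω] (h : IsSubadditiveCocycle T Φ C) : 0 ≤ C := by
  obtain ⟨ω⟩ := ‹Nonempty Ω›
  simpa using (abs_nonneg _).trans (h.abs_le 1 ω)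

theorem abs_div_le (h : IsSubadditiveCocycle T Φ C) (n : ℕ) (ω : Ω) : |Φ n ω / n| ≤ C := by
  have : Nonempty Ω := ⟨ω⟩
  rw [abs_div, Nat.abs_cast]
  exact div_le_of_le_mul₀ n.cast_nonneg h.nonneg (h.abs_le n ω)

variable [MeasurableSpace Ω]

theorem abs_integral_le (h : IsSubadditiveCocycle T Φ C) (n : ℕ) (μ : Measure Ω)
    [IsProbabilityMeasure μ] : |∫ ω, Φ n ω ∂μ| ≤ C * n := by
  simpa using norm_integral_le_of_norm_le_const (f := Φ n) (ae_of_all μ (h.abs_le n))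

variable [OpensMeasurableSpace Ω]

theorem integrable (h : IsSubadditiveCocycle T Φ C) (n : ℕ) (μ : Measure Ω) [IsFiniteMeasure μ] :
    Integrable (Φ n) μ :=
  Integrable.of_bound (h.continuous n).measurable.aestronglyMeasurable (C * n)
    (ae_of_all _ (h.abs_le n))

theorem integral_add_le (h : IsSubadditiveCocycle T Φ C) (hT : Measurable T) (μ : Measure Ω)
    [IsProbabilityMeasure μ] (m n : ℕ) :
    ∫ ω, Φ (m + n) ω ∂μ ≤ ∫ ω, Φ m ω ∂μ + ∫ ω, Φ n ω ∂(μ.map T^[m]) := by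
  have hTm := hT.iterate m
  have hint : Integrable (fun ω => Φ n (T^[m] ω)) μ :=
    (h.integrable n (μ.map T^[m])).comp_measurable hTm
  rw [integral_map hTm.aemeasurable (h.continuous n).measurable.aestronglyMeasurable,
    ← integral_add (h.integrable m μ) hint]
  exact integral_mono (h.integrable _ μ) ((h.integrable m μ).add hint) (h.add_le m n)

variable [Fintype ι]

theorem sum_mul_freeEnergy_le (h : IsSubadditiveCocycle T Φ C) (p : Ω → ι) (n : ℕ) {J : Type*}
    (s : Finset J) {c : J → ℝ≥0} (hc : ∑ j ∈ s, c j = 1) (μ : J → Measure Ω)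
    [∀ j, IsFiniteMeasure (μ j)] :
    ∑ j ∈ s, c j * freeEnergy T p Φ n (μ j) ≤ freeEnergy T p Φ n (∑ j ∈ s, c j • μ j) := by
  simp only [freeEnergy, mul_add, Finset.sum_add_distrib]
  rw [integral_finsetSum_measure fun j _ => h.integrable n (c j • μ j)]
  simp only [integral_smul_nnreal_measure, NNReal.smul_def, smul_eq_mul]
  gcongr
  exact sum_mul_partitionEntropy_le s hc μ _

variable [MeasurableSpace ι] [MeasurableSingletonClass ι] {p : Ω → ι}
  (h : IsSubadditiveCocycle T Φ C) (hT : Measurable T) (hp : Measurable p)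
include h hT hp

theorem freeEnergy_add_le (μ : Measure Ω) [IsProbabilityMeasure μ] (m n : ℕ) :
    freeEnergy T p Φ (m + n) μ ≤ freeEnergy T p Φ m μ + freeEnergy T p Φ n (μ.map T^[m]) := by
  have hH := partitionEntropy_itinerary_add_le hT hp μ m n
  have hΦ := h.integral_add_le hT μ m n
  simp only [freeEnergy]
  linarith

theorem freeEnergy_add_measure_le (n : ℕ) (a b : ℝ≥0) (μ₁ μ₂ : Measure Ω)
    [IsProbabilityMeasure μ₁] [IsProbabilityMeasure μ₂] :
    freeEnergy T p Φ n (a • μ₁ + b • μ₂) ≤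
      a * freeEnergy T p Φ n μ₁ + b * freeEnergy T p Φ n μ₂ +
        (Real.negMulLog a + Real.negMulLog b) := by
  have hH := partitionEntropy_add_le a b μ₁ μ₂ (measurable_itinerary hT hp n)
  simp only [freeEnergy]
  rw [integral_add_measure (h.integrable n _) (h.integrable n _), integral_smul_nnreal_measure,
    integral_smul_nnreal_measure, NNReal.smul_def, NNReal.smul_def, smul_eq_mul, smul_eq_mul]
  linarith

omit [OpensMeasurableSpace Ω] in
theorem abs_freeEnergy_le (μ : Measure Ω) [IsProbabilityMeasure μ] (n : ℕ) :
    |freeEnergy T p Φ n μ| ≤ (Real.log (Fintype.card ι) + C) * n := by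
  rw [freeEnergy, add_mul]
  refine (abs_add_le _ _).trans (add_le_add ?_ (h.abs_integral_le n μ))
  rw [abs_of_nonneg (partitionEntropy_nonneg μ _)]
  exact partitionEntropy_itinerary_le hT hp μ n

omit [OpensMeasurableSpace Ω] in
theorem bddBelow_freeEnergy_div (μ : Measure Ω) [IsProbabilityMeasure μ] :
    BddBelow (Set.range fun n : ℕ => freeEnergy T p Φ n μ / n) := by
  have : Nonempty Ω := nonempty_of_isProbabilityMeasure μ
  have hslope : 0 ≤ Real.log (Fintype.card ι) + C :=
    add_nonneg (Real.log_natCast_nonneg _) h.nonneg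
  refine ⟨-(Real.log (Fintype.card ι) + C), Set.forall_mem_range.2 fun n => ?_⟩
  refine (_root_.abs_le.1 ?_).1
  rw [abs_div, Nat.abs_cast]
  exact div_le_of_le_mul₀ n.cast_nonneg hslope (h.abs_freeEnergy_le hT hp μ n)

omit [OpensMeasurableSpace Ω] in
theorem bddBelow_freeEnergy_div_Ici (μ : Measure Ω) [IsProbabilityMeasure μ] :
    BddBelow (Set.range fun n : Set.Ici 1 => freeEnergy T p Φ n μ / (n : ℕ)) :=
  (h.bddBelow_freeEnergy_div hT hp μ).mono (Set.range_comp_subset_range Subtype.val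
    fun n : ℕ => freeEnergy T p Φ n μ / n)

omit [OpensMeasurableSpace Ω] in
theorem asymptoticFreeEnergy_le_freeEnergy_div (μ : Measure Ω) [IsProbabilityMeasure μ] {n : ℕ}
    (hn : 1 ≤ n) : asymptoticFreeEnergy T p Φ μ ≤ freeEnergy T p Φ n μ / n :=
  ciInf_le (h.bddBelow_freeEnergy_div_Ici hT hp μ) ⟨n, hn⟩

theorem tendsto_freeEnergy_div {μ : Measure Ω} [IsProbabilityMeasure μ]
    (hμ : MeasurePreserving T μ μ) :
    Tendsto (fun n : ℕ => freeEnergy T p Φ n μ / n) atTop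
      (𝓝 (asymptoticFreeEnergy T p Φ μ)) := by
  have hsub : Subadditive fun n => freeEnergy T p Φ n μ := fun m n => by
    simpa only [(hμ.iterate m).map_eq] using h.freeEnergy_add_le hT hp μ m n
  have hlim : hsub.lim = asymptoticFreeEnergy T p Φ μ := by
    rw [Subadditive.lim, sInf_image', asymptoticFreeEnergy]
  exact hlim ▸ hsub.tendsto_lim (h.bddBelow_freeEnergy_div hT hp μ)

theorem asymptoticFreeEnergy_add_measure_le {a b : ℝ≥0} (hab : a + b = 1) {μ₁ μ₂ : Measure Ω}
    [IsProbabilityMeasure μ₁] [IsProbabilityMeasure μ₂] (hμ₁ : MeasurePreserving T μ₁ μ₁)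
    (hμ₂ : MeasurePreserving T μ₂ μ₂) :
    asymptoticFreeEnergy T p Φ (a • μ₁ + b • μ₂) ≤
      a * asymptoticFreeEnergy T p Φ μ₁ + b * asymptoticFreeEnergy T p Φ μ₂ := by
  have : IsProbabilityMeasure (a • μ₁ + b • μ₂) := ⟨by
    rw [Measure.add_apply, Measure.smul_apply, Measure.smul_apply, measure_univ, measure_univ,
      ENNReal.smul_def, ENNReal.smul_def, smul_eq_mul, smul_eq_mul, mul_one, mul_one,
      ← ENNReal.coe_add, hab, ENNReal.coe_one]⟩
  have hμ : MeasurePreserving T (a • μ₁ + b • μ₂) (a • μ₁ + b • μ₂) := ⟨hT, by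
    rw [Measure.map_add _ _ hT, Measure.map_smul, Measure.map_smul, hμ₁.map_eq, hμ₂.map_eq]⟩
  have hlim := (((h.tendsto_freeEnergy_div hT hp hμ₁).const_mul (a : ℝ)).add
    ((h.tendsto_freeEnergy_div hT hp hμ₂).const_mul (b : ℝ))).add
      (tendsto_const_div_atTop_nhds_zero_nat (Real.negMulLog a + Real.negMulLog b))
  rw [add_zero] at hlim
  refine le_of_tendsto_of_tendsto' (h.tendsto_freeEnergy_div hT hp hμ) hlim fun n => ?_
  rw [← mul_div_assoc, ← mul_div_assoc, ← add_div, ← add_div]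
  exact div_le_div_of_nonneg_right (h.freeEnergy_add_measure_le hT hp n a b μ₁ μ₂) n.cast_nonneg

end IsSubadditiveCocycle

end FreeEnergy

theorem measurable_of_isLocallyConstant {Ω ι : Type*} [TopologicalSpace Ω] [MeasurableSpace Ω]
    [OpensMeasurableSpace Ω] [MeasurableSpace ι] {p : Ω → ι} (hp : IsLocallyConstant p) :
    Measurable p :=
  fun s _ => (hp s).measurableSet

namespace IsSubadditiveCocycle

variable {Ω ι : Type*} [TopologicalSpace Ω] [CompactSpace Ω] [MeasurableSpace Ω] [BorelSpace Ω]
  [HasOuterApproxClosed Ω] [Fintype ι] {T : Ω → Ω} {p : Ω → ι} {Φ : ℕ → Ω → ℝ} {C : ℝ}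

theorem continuous_freeEnergy (h : IsSubadditiveCocycle T Φ C) (hT : Continuous T)
    (hp : IsLocallyConstant p) (n : ℕ) :
    Continuous fun μ : ProbabilityMeasure Ω => freeEnergy T p Φ n μ := by
  refine Continuous.add (continuous_finsetSum _ fun i _ => ?_)
    (ProbabilityMeasure.continuous_integral_continuousMap (⟨Φ n, h.continuous n⟩ : C(Ω, ℝ)))
  have hclopen := (isLocallyConstant_itinerary hT hp n).isClopen_fiber i
  have hcell : Continuous fun μ : ProbabilityMeasure Ω => μ (itinerary T p n ⁻¹' {i}) :=
    continuous_iff_continuousAt.2 fun μ =>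
      ProbabilityMeasure.tendsto_measure_of_isClopen_of_tendsto tendsto_id hclopen
  exact Real.continuous_negMulLog.comp (NNReal.continuous_coe.comp hcell)

variable [MeasurableSpace ι] [MeasurableSingletonClass ι]

theorem upperSemicontinuous_asymptoticFreeEnergy (h : IsSubadditiveCocycle T Φ C)
    (hT : Continuous T) (hp : IsLocallyConstant p) :
    UpperSemicontinuous fun μ : ProbabilityMeasure Ω => asymptoticFreeEnergy T p Φ μ :=
  upperSemicontinuous_ciInf
    (fun μ => h.bddBelow_freeEnergy_div_Ici hT.measurable (measurable_of_isLocallyConstant hp) μ)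
    fun n => ((h.continuous_freeEnergy hT hp n).div_const _).upperSemicontinuous

end IsSubadditiveCocycle

theorem sum_range_add_le_sum_range_add_sum {u v : ℕ → ℝ} {q : ℕ}
    (h : ∀ m, u (m + q) ≤ u m + v m) (n : ℕ) :
    ∑ j ∈ Finset.range q, u (n + j) ≤
      ∑ j ∈ Finset.range q, u j + ∑ i ∈ Finset.range n, v i := by
  induction n with
  | zero => simp
  | succ n ih =>
    have hshift : ∑ j ∈ Finset.range q, u (n + 1 + j) + u n =
        ∑ j ∈ Finset.range q, u (n + j) + u (n + q) := by
      rw [← Finset.sum_range_succ (fun j => u (n + j)),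
        Finset.sum_range_succ' (fun j => u (n + j))]
      simp only [add_zero, add_assoc, add_comm 1]
    rw [Finset.sum_range_succ]
    linarith [h n]

theorem mul_le_sum_range_add_of_add_le {a : ℕ → ℕ → ℝ} {D : ℝ}
    (hadd : ∀ m n, a 0 (m + n) ≤ a 0 m + a m n) (hD : ∀ i n, |a i n| ≤ D * n) {q n : ℕ}
    (hqn : q ≤ n) : q * a 0 n ≤ ∑ i ∈ Finset.range n, a i q + 3 * D * q ^ 2 := by
  obtain ⟨r, rfl⟩ := Nat.exists_eq_add_of_le' hqn
  have hD0 : 0 ≤ D := by simpa using (abs_nonneg _).trans (hD 0 1)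
  have hblock : ∀ i j, j ≤ q → a i j ≤ D * q := fun i j hj =>
    (le_abs_self _).trans ((hD i j).trans (by gcongr))
  -- For each offset `j < q`, cut `[j, n)` into blocks of length `q`. Over all `j`, every
  -- `i < n - q` is the left end of one block, and the leftover pieces cost at most `3 D q²`.
  have hend : ∑ _j ∈ Finset.range q, a 0 (r + q) ≤
      ∑ j ∈ Finset.range q, (a 0 (r + j) + D * q) := Finset.sum_le_sum fun j hj => by
    have hjq := (Finset.mem_range.1 hj).le
    have hsplit := hadd (r + j) (q - j)
    rw [add_assoc, Nat.add_sub_cancel' hjq] at hsplit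
    linarith [hblock (r + j) (q - j) (Nat.sub_le q j)]
  have hstart : ∑ j ∈ Finset.range q, a 0 j ≤ ∑ _j ∈ Finset.range q, D * q :=
    Finset.sum_le_sum fun j hj => hblock 0 j (Finset.mem_range.1 hj).le
  have hlast : ∑ _j ∈ Finset.range q, -(D * q) ≤ ∑ j ∈ Finset.range q, a (r + j) q :=
    Finset.sum_le_sum fun j _ => (abs_le.1 (hD (r + j) q)).1
  rw [Finset.sum_add_distrib] at hend
  rw [Finset.sum_range_add]
  simp only [Finset.sum_const, Finset.card_range, nsmul_eq_mul] at hend hstart hlast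
  linarith [sum_range_add_le_sum_range_add_sum (hadd · q) r]

section OrbitAverage

variable {Ω : Type*} [MeasurableSpace Ω]

/-- The average of `σ, T₊σ, …, T₊ⁿ⁻¹σ`, the candidate for an approximately invariant measure; it
is the zero measure for `n = 0`. -/
noncomputable def orbitAverage (T : Ω → Ω) (σ : Measure Ω) (n : ℕ) : Measure Ω :=
  ∑ i ∈ Finset.range n, (n : ℝ≥0)⁻¹ • σ.map T^[i]

variable {T : Ω → Ω}

theorem sum_range_const_inv_eq_one {n : ℕ} (hn : n ≠ 0) :
    ∑ _i ∈ Finset.range n, (n : ℝ≥0)⁻¹ = 1 := by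
  rw [Finset.sum_const, Finset.card_range, nsmul_eq_mul, mul_inv_cancel₀ (Nat.cast_ne_zero.2 hn)]

theorem isProbabilityMeasure_orbitAverage (hT : Measurable T) (σ : Measure Ω)
    [IsProbabilityMeasure σ] {n : ℕ} (hn : n ≠ 0) :
    IsProbabilityMeasure (orbitAverage T σ n) := by
  have (i : ℕ) : IsProbabilityMeasure (σ.map T^[i]) :=
    Measure.isProbabilityMeasure_map (hT.iterate i).aemeasurable
  refine ⟨?_⟩
  simp only [orbitAverage, Measure.finsetSum_apply, Measure.smul_apply, measure_univ,
    ENNReal.smul_def, smul_eq_mul, mul_one]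
  rw [← ENNReal.ofNNReal_finsetSum, sum_range_const_inv_eq_one hn, ENNReal.coe_one]

theorem abs_integral_comp_sub_integral_orbitAverage_le (hT : Measurable T) (σ : Measure Ω)
    [IsProbabilityMeasure σ] {f : Ω → ℝ} (hf : Measurable f) {B : ℝ} (hB : ∀ ω, |f ω| ≤ B)
    (n : ℕ) :
    |∫ ω, f (T ω) ∂orbitAverage T σ n - ∫ ω, f ω ∂orbitAverage T σ n| ≤ 2 * B / n := by
  have hprob (i : ℕ) : IsProbabilityMeasure (σ.map T^[i]) :=
    Measure.isProbabilityMeasure_map (hT.iterate i).aemeasurable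
  have hint (i : ℕ) : Integrable f ((n : ℝ≥0)⁻¹ • σ.map T^[i]) :=
    .of_bound hf.aestronglyMeasurable B (ae_of_all _ hB)
  have hintT (i : ℕ) : Integrable (fun ω => f (T ω)) ((n : ℝ≥0)⁻¹ • σ.map T^[i]) :=
    .of_bound (hf.comp hT).aestronglyMeasurable B (ae_of_all _ fun ω => hB (T ω))
  have hshift (i : ℕ) : ∫ ω, f (T ω) ∂(σ.map T^[i]) = ∫ ω, f ω ∂(σ.map T^[i + 1]) := by
    rw [Function.iterate_succ', ← Measure.map_map hT (hT.iterate i),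
      integral_map hT.aemeasurable hf.aestronglyMeasurable]
  have hbound (i : ℕ) : |∫ ω, f ω ∂(σ.map T^[i])| ≤ B := by
    simpa using norm_integral_le_of_norm_le_const (μ := σ.map T^[i]) (f := f) (ae_of_all _ hB)
  rw [orbitAverage, integral_finsetSum_measure fun i _ => hint i,
    integral_finsetSum_measure fun i _ => hintT i, ← Finset.sum_sub_distrib]
  simp only [integral_smul_nnreal_measure, hshift, ← smul_sub]
  rw [← Finset.smul_sum, Finset.sum_range_sub (fun i => ∫ ω, f ω ∂(σ.map T^[i])),
    NNReal.smul_def, smul_eq_mul, abs_mul, NNReal.abs_eq, NNReal.coe_inv, NNReal.coe_natCast,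
    inv_mul_eq_div]
  gcongr
  linarith [abs_sub (∫ ω, f ω ∂(σ.map T^[n])) (∫ ω, f ω ∂(σ.map T^[0])), hbound n, hbound 0]

variable [TopologicalSpace Ω] [BorelSpace Ω] [HasOuterApproxClosed Ω]

theorem measurePreserving_of_tendsto_integral_comp_sub {α : Type*} {l : Filter α} [NeBot l]
    {μ : α → ProbabilityMeasure Ω} {ν : ProbabilityMeasure Ω} (hT : Continuous T)
    (hμ : Tendsto μ l (𝓝 ν))
    (hinv : ∀ f : BoundedContinuousFunction Ω ℝ,
      Tendsto (fun i => ∫ ω, f (T ω) ∂(μ i : Measure Ω) - ∫ ω, f ω ∂(μ i : Measure Ω)) l (𝓝 0)) :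
    MeasurePreserving T (ν : Measure Ω) ν := by
  rw [ProbabilityMeasure.tendsto_iff_forall_integral_tendsto] at hμ
  refine ⟨hT.measurable, ?_⟩
  have := Measure.isProbabilityMeasure_map (μ := (ν : Measure Ω)) hT.aemeasurable
  refine ext_of_forall_integral_eq_of_IsFiniteMeasure fun f => ?_
  rw [integral_map hT.aemeasurable f.continuous.measurable.aestronglyMeasurable]
  have hlim := (hinv f).add (hμ f)
  simp only [sub_add_cancel, zero_add] at hlim
  exact tendsto_nhds_unique (hμ (f.compContinuous ⟨T, hT⟩)) hlim

end OrbitAverage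

namespace IsSubadditiveCocycle

variable {Ω ι : Type*} [TopologicalSpace Ω] [MeasurableSpace Ω] [BorelSpace Ω]
  [Fintype ι] [MeasurableSpace ι] [MeasurableSingletonClass ι] {T : Ω → Ω} {p : Ω → ι}
  {Φ : ℕ → Ω → ℝ} {C : ℝ}

theorem mul_freeEnergy_div_le_freeEnergy_orbitAverage (h : IsSubadditiveCocycle T Φ C)
    (hT : Measurable T) (hp : Measurable p) (σ : Measure Ω) [IsProbabilityMeasure σ] {q n : ℕ}
    (hn : n ≠ 0) (hqn : q ≤ n) :
    q * (freeEnergy T p Φ n σ / n) ≤ freeEnergy T p Φ q (orbitAverage T σ n) +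
      3 * (Real.log (Fintype.card ι) + C) * q ^ 2 / n := by
  have (i : ℕ) : IsProbabilityMeasure (σ.map T^[i]) :=
    Measure.isProbabilityMeasure_map (hT.iterate i).aemeasurable
  have hblocks := mul_le_sum_range_add_of_add_le
    (a := fun i n => freeEnergy T p Φ n (σ.map T^[i]))
    (fun m n => by simpa using h.freeEnergy_add_le hT hp σ m n)
    (fun i n => h.abs_freeEnergy_le hT hp _ n) hqn
  have hconcave := h.sum_mul_freeEnergy_le p q (Finset.range n) (sum_range_const_inv_eq_one hn)
    fun i => σ.map T^[i]
  rw [← Finset.mul_sum, NNReal.coe_inv, NNReal.coe_natCast, inv_mul_eq_div] at hconcave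
  rw [mul_div_assoc']
  calc q * freeEnergy T p Φ n σ / n
    _ ≤ (∑ i ∈ Finset.range n, freeEnergy T p Φ q (σ.map T^[i]) +
        3 * (Real.log (Fintype.card ι) + C) * q ^ 2) / n := by
      refine div_le_div_of_nonneg_right ?_ n.cast_nonneg
      simpa only [Function.iterate_zero, Measure.map_id] using hblocks
    _ ≤ _ := by
      rw [add_div]
      exact add_le_add_left hconcave _

theorem exists_measurePreserving_le_asymptoticFreeEnergy [CompactSpace Ω]
    [T2Space Ω] [HasOuterApproxClosed Ω] (h : IsSubadditiveCocycle T Φ C) (hT : Continuous T)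
    (hp : IsLocallyConstant p) {c : ℝ}
    (hc : ∃ᶠ n : ℕ in atTop, ∃ σ : Measure Ω, IsProbabilityMeasure σ ∧
      c * n ≤ freeEnergy T p Φ n σ) :
    ∃ ν : ProbabilityMeasure Ω, MeasurePreserving T (ν : Measure Ω) ν ∧
      c ≤ asymptoticFreeEnergy T p Φ ν := by
  obtain ⟨g, hg, hgood⟩ := extraction_of_frequently_atTop
    (hc.and_eventually (eventually_ne_atTop 0))
  choose! σ hσ hσc using fun i => (hgood i).1
  have hg0 (i : ℕ) : g i ≠ 0 := (hgood i).2
  let μ (i : ℕ) : ProbabilityMeasure Ω :=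
    ⟨orbitAverage T (σ i) (g i), isProbabilityMeasure_orbitAverage hT.measurable _ (hg0 i)⟩
  let ν : ProbabilityMeasure Ω := ((hyperfilter ℕ).map μ).lim
  have hμν : Tendsto μ (hyperfilter ℕ) (𝓝 ν) := ((hyperfilter ℕ).map μ).le_nhds_lim
  have hsmall (B : ℝ) : Tendsto (fun i => B / g i) (hyperfilter ℕ) (𝓝 0) :=
    ((tendsto_const_div_atTop_nhds_zero_nat B).comp hg.tendsto_atTop).mono_left
      Nat.hyperfilter_le_atTop
  refine ⟨ν, measurePreserving_of_tendsto_integral_comp_sub hT hμν fun f => ?_,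
    le_ciInf fun q => ?_⟩
  · exact squeeze_zero_norm (fun i => abs_integral_comp_sub_integral_orbitAverage_le
      hT.measurable (σ i) f.continuous.measurable f.norm_coe_le_norm (g i)) (hsmall (2 * ‖f‖))
  obtain ⟨q, hq⟩ := q
  have hq0 : (0 : ℝ) < q := by exact_mod_cast (Set.mem_Ici.1 hq)
  rw [le_div_iff₀ hq0]
  have hlim := (((h.continuous_freeEnergy hT hp q).tendsto ν).comp hμν).add
    (hsmall (3 * (Real.log (Fintype.card ι) + C) * q ^ 2))
  rw [add_zero] at hlim
  refine ge_of_tendsto hlim (Nat.hyperfilter_le_atTop ?_)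
  filter_upwards [hg.tendsto_atTop.eventually_ge_atTop q] with i hqi
  have hgi : (0 : ℝ) < g i := by exact_mod_cast (hg0 i).bot_lt
  calc c * q ≤ q * (freeEnergy T p Φ (g i) (σ i) / g i) := by
        rw [mul_comm]
        gcongr
        exact (le_div_iff₀ hgi).2 (hσc i)
    _ ≤ _ := h.mul_freeEnergy_div_le_freeEnergy_orbitAverage hT.measurable
      (measurable_of_isLocallyConstant hp) (σ i) (hg0 i) hqi

end IsSubadditiveCocycle

section ErgodicMaximizer

variable {Ω : Type*} [TopologicalSpace Ω] [CompactSpace Ω] [MeasurableSpace Ω] [BorelSpace Ω]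
  [HasOuterApproxClosed Ω]

theorem exists_mem_eq_of_eq_add_of_isCompact {K : Set (ProbabilityMeasure Ω)} (hK : IsCompact K)
    (hne : K.Nonempty) :
    ∃ ν ∈ K, ∀ κ₁ ∈ K, ∀ κ₂ ∈ K, ∀ a b : ℝ≥0, 0 < a → 0 < b → a + b = 1 →
      (ν : Measure Ω) = a • (κ₁ : Measure Ω) + b • (κ₂ : Measure Ω) → κ₁ = ν := by
  -- Krein–Milman needs a locally convex space: embed the measures into functionals on `C(Ω, ℝ)`.
  let J : ProbabilityMeasure Ω → C(Ω, ℝ) → ℝ := fun ν f => ∫ ω, f ω ∂(ν : Measure Ω)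
  have hJ : Continuous J := continuous_pi ProbabilityMeasure.continuous_integral_continuousMap
  have hJinj : Function.Injective J := fun μ ν hμν => ProbabilityMeasure.toMeasure_injective <|
    ext_of_forall_integral_eq_of_IsFiniteMeasure fun f => congrFun hμν f.toContinuousMap
  obtain ⟨_, ⟨ν, hν, rfl⟩, hext⟩ := (hK.image hJ).extremePoints_nonempty (hne.image J)
  refine ⟨ν, hν, fun κ₁ hκ₁ κ₂ hκ₂ a b ha hb hab hsum => hJinj ?_⟩
  refine hext ⟨κ₁, hκ₁, rfl⟩ ⟨κ₂, hκ₂, rfl⟩ ⟨a, b, ha, hb, by exact_mod_cast hab, ?_⟩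
  funext f
  have hint (κ : Measure Ω) [IsFiniteMeasure κ] : Integrable f κ :=
    (BoundedContinuousFunction.mkOfCompact f).integrable κ
  simp only [J, Pi.add_apply, Pi.smul_apply]
  rw [hsum, integral_add_measure (hint _) (hint _), integral_smul_nnreal_measure,
    integral_smul_nnreal_measure, NNReal.smul_def, NNReal.smul_def]

variable {T : Ω → Ω}

omit [CompactSpace Ω] in
theorem isClosed_setOf_measurePreserving (hT : Continuous T) :
    IsClosed {ν : ProbabilityMeasure Ω | MeasurePreserving T (ν : Measure Ω) ν} := by
  convert isClosed_eq (ProbabilityMeasure.continuous_map hT) continuous_id with ν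
  rw [← ProbabilityMeasure.toMeasure_injective.eq_iff]
  exact ⟨fun h => h.map_eq, fun h => ⟨hT.measurable, h⟩⟩

omit [TopologicalSpace Ω] [CompactSpace Ω] [BorelSpace Ω] [HasOuterApproxClosed Ω] in
theorem ergodic_of_forall_eq_of_eq_add {ν : ProbabilityMeasure Ω}
    (hν : MeasurePreserving T (ν : Measure Ω) ν)
    (hext : ∀ κ₁ κ₂ : ProbabilityMeasure Ω, MeasurePreserving T (κ₁ : Measure Ω) κ₁ →
      MeasurePreserving T (κ₂ : Measure Ω) κ₂ → ∀ a b : ℝ≥0, 0 < a → 0 < b → a + b = 1 →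
      (ν : Measure Ω) = a • (κ₁ : Measure Ω) + b • (κ₂ : Measure Ω) → κ₁ = ν) :
    Ergodic T (ν : Measure Ω) := by
  refine .of_mem_extremePoints ⟨⟨hν, inferInstance⟩, ?_⟩
  rintro κ₁ ⟨hκ₁, hprob₁⟩ κ₂ ⟨hκ₂, hprob₂⟩ ⟨a, b, ha, hb, hab, hsum⟩
  lift a to ℝ≥0 using ne_top_of_le_ne_top ENNReal.one_ne_top (hab ▸ le_self_add)
  lift b to ℝ≥0 using ne_top_of_le_ne_top ENNReal.one_ne_top (hab ▸ le_add_self)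
  exact congrArg ((↑) : ProbabilityMeasure Ω → Measure Ω)
    (hext ⟨κ₁, hprob₁⟩ ⟨κ₂, hprob₂⟩ hκ₁ hκ₂ a b (by exact_mod_cast ha) (by exact_mod_cast hb)
      (by exact_mod_cast hab) hsum.symm)

theorem exists_ergodic_forall_measurePreserving_le [T2Space Ω] (hT : Continuous T)
    {G : ProbabilityMeasure Ω → ℝ} (hG : UpperSemicontinuous G)
    (hconv : ∀ (κ κ₁ κ₂ : ProbabilityMeasure Ω) (a b : ℝ≥0), a + b = 1 →
      MeasurePreserving T (κ₁ : Measure Ω) κ₁ → MeasurePreserving T (κ₂ : Measure Ω) κ₂ →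
      (κ : Measure Ω) = a • (κ₁ : Measure Ω) + b • (κ₂ : Measure Ω) → G κ ≤ a * G κ₁ + b * G κ₂)
    {ν₀ : ProbabilityMeasure Ω} (hν₀ : MeasurePreserving T (ν₀ : Measure Ω) ν₀) :
    ∃ ν : ProbabilityMeasure Ω, Ergodic T (ν : Measure Ω) ∧
      ∀ κ : ProbabilityMeasure Ω, MeasurePreserving T (κ : Measure Ω) κ → G κ ≤ G ν := by
  have hclosed := isClosed_setOf_measurePreserving hT
  obtain ⟨μ, hμ, hmax⟩ := (hG.upperSemicontinuousOn _).exists_isMaxOn ⟨ν₀, hν₀⟩ hclosed.isCompact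
  have hmax' (κ : ProbabilityMeasure Ω) (hκ : MeasurePreserving T (κ : Measure Ω) κ) :
      G κ ≤ G μ := hmax hκ
  -- By convexity, the maximisers form a face of the set of invariant measures, so a point that is
  -- extreme among the maximisers is extreme among all invariant measures.
  obtain ⟨ν, ⟨hν, hμν⟩, hext⟩ := exists_mem_eq_of_eq_add_of_isCompact
    (hclosed.inter (hG.isClosed_preimage (G μ))).isCompact ⟨μ, hμ, le_refl (G μ)⟩
  have hface (κ₁ κ₂ : ProbabilityMeasure Ω) (a b : ℝ≥0) (ha : 0 < a) (hab : a + b = 1)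
      (hκ₁ : MeasurePreserving T (κ₁ : Measure Ω) κ₁)
      (hκ₂ : MeasurePreserving T (κ₂ : Measure Ω) κ₂)
      (hsum : (ν : Measure Ω) = a • (κ₁ : Measure Ω) + b • (κ₂ : Measure Ω)) : G μ ≤ G κ₁ := by
    have hle : G μ ≤ a * G κ₁ + b * G μ :=
      (Set.mem_Ici.1 hμν).trans ((hconv ν κ₁ κ₂ a b hab hκ₁ hκ₂ hsum).trans (by
        gcongr
        exact hmax' κ₂ hκ₂))
    have hab' : (a : ℝ) + b = 1 := by exact_mod_cast hab
    refine le_of_mul_le_mul_left ?_ (NNReal.coe_pos.2 ha)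
    linear_combination hle + G μ * hab'
  refine ⟨ν, ergodic_of_forall_eq_of_eq_add hν fun κ₁ κ₂ hκ₁ hκ₂ a b ha hb hab hsum => ?_,
    fun κ hκ => (hmax' κ hκ).trans hμν⟩
  exact hext κ₁ ⟨hκ₁, hface κ₁ κ₂ a b ha hab hκ₁ hκ₂ hsum⟩ κ₂
    ⟨hκ₂, hface κ₂ κ₁ b a hb (add_comm a b ▸ hab) hκ₂ hκ₁ (by rw [hsum, add_comm])⟩
    a b ha hb hab hsum

end ErgodicMaximizer

section GibbsMeasure

variable {W : Type*} [Fintype W] [Nonempty W]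

theorem sum_exp_pos (f : W → ℝ) : 0 < ∑ w, Real.exp (f w) :=
  Finset.sum_pos (fun _ _ => Real.exp_pos _) Finset.univ_nonempty

/-- The Gibbs distribution of the energy `f`, with weights proportional to `exp (f w)`. It attains
equality in Gibbs' variational inequality. -/
noncomputable def gibbsPMF (f : W → ℝ) : PMF W :=
  PMF.ofFintype (fun w => ENNReal.ofReal (Real.exp (f w) / ∑ v, Real.exp (f v))) <| by
    rw [← ENNReal.ofReal_sum_of_nonneg fun w _ => div_nonneg (Real.exp_pos _).le (sum_exp_pos f).le,
      ← Finset.sum_div, div_self (sum_exp_pos f).ne', ENNReal.ofReal_one]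

variable [MeasurableSpace W] [MeasurableSingletonClass W]

theorem measureReal_gibbsPMF_singleton (f : W → ℝ) (w : W) :
    (gibbsPMF f).toMeasure.real {w} = Real.exp (f w) / ∑ v, Real.exp (f v) := by
  rw [measureReal_def, PMF.toMeasure_apply_singleton _ _ (measurableSet_singleton w), gibbsPMF,
    PMF.ofFintype_apply, ENNReal.toReal_ofReal (div_nonneg (Real.exp_pos _).le (sum_exp_pos f).le)]

theorem sum_negMulLog_add_integral_gibbsPMF (f : W → ℝ) :
    ∑ w, Real.negMulLog ((gibbsPMF f).toMeasure.real {w}) + ∫ w, f w ∂(gibbsPMF f).toMeasure =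
      Real.log (∑ w, Real.exp (f w)) := by
  set Z := ∑ w, Real.exp (f w) with hZ
  have hterm (w : W) : Real.negMulLog (Real.exp (f w) / Z) + Real.exp (f w) / Z * f w =
      Real.exp (f w) / Z * Real.log Z := by
    rw [Real.negMulLog, Real.log_div (Real.exp_pos _).ne' (sum_exp_pos f).ne', Real.log_exp]
    ring
  rw [integral_fintype .of_finite]
  simp only [measureReal_gibbsPMF_singleton, smul_eq_mul, ← hZ]
  rw [← Finset.sum_add_distrib, Finset.sum_congr rfl fun w _ => hterm w, ← Finset.sum_mul,
    ← Finset.sum_div, div_self (sum_exp_pos f).ne', one_mul]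

theorem freeEnergy_map_gibbsPMF {Ω ι : Type*} [MeasurableSpace Ω] [Fintype ι] [MeasurableSpace ι]
    [MeasurableSingletonClass ι] {T : Ω → Ω} {p : Ω → ι} {Φ : ℕ → Ω → ℝ} {n : ℕ}
    (hT : Measurable T) (hp : Measurable p) (hΦ : Measurable (Φ n)) {x : W → Ω}
    (hx : Function.Injective (itinerary T p n ∘ x)) :
    freeEnergy T p Φ n ((gibbsPMF fun w => Φ n (x w)).toMeasure.map x) =
      Real.log (∑ w, Real.exp (Φ n (x w))) := by
  have hxm : Measurable x := .of_discrete
  rw [freeEnergy, partitionEntropy_map _ hxm (measurable_itinerary hT hp n),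
    partitionEntropy_of_injective _ hx, integral_map hxm.aemeasurable hΦ.aestronglyMeasurable,
    sum_negMulLog_add_integral_gibbsPMF]

end GibbsMeasure

namespace IsSubadditiveCocycle

variable {Ω ι : Type*} [TopologicalSpace Ω] [MeasurableSpace Ω] [OpensMeasurableSpace Ω]
  [Fintype ι] [MeasurableSpace ι] [MeasurableSingletonClass ι] {T : Ω → Ω} {p : Ω → ι}
  {Φ : ℕ → Ω → ℝ} {C : ℝ}

theorem exists_mul_le_freeEnergy (h : IsSubadditiveCocycle T Φ C) (hT : Measurable T)
    (hp : Measurable p) {W : Type*} [Fintype W] {n : ℕ} (hn : n ≠ 0) {x : W → Ω}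
    (hx : Function.Injective (itinerary T p n ∘ x)) {c : ℝ}
    (hc : (c : EReal) < ENNReal.log (ENNReal.ofReal (∑ w, Real.exp (Φ n (x w)))) / (n : EReal)) :
    ∃ σ : Measure Ω, IsProbabilityMeasure σ ∧ c * n ≤ freeEnergy T p Φ n σ := by
  have hn' : (0 : ℝ) < n := by exact_mod_cast hn.bot_lt
  cases isEmpty_or_nonempty W
  · rw [Fintype.sum_empty, ENNReal.ofReal_zero, ENNReal.log_zero,
      EReal.bot_div_of_pos_ne_top (by exact_mod_cast hn') (EReal.natCast_ne_top n)] at hc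
    exact absurd hc not_lt_bot
  let : MeasurableSpace W := ⊤
  refine ⟨(gibbsPMF fun w => Φ n (x w)).toMeasure.map x,
    Measure.isProbabilityMeasure_map Measurable.of_discrete.aemeasurable, ?_⟩
  rw [freeEnergy_map_gibbsPMF hT hp (h.continuous n).measurable hx]
  rw [ENNReal.log_ofReal_of_pos (sum_exp_pos _), ← EReal.coe_natCast, ← EReal.coe_div,
    EReal.coe_lt_coe_iff] at hc
  exact ((lt_div_iff₀ hn').1 hc).le

omit [Fintype ι] [MeasurableSpace ι] [MeasurableSingletonClass ι] in
theorem integrable_limsup_div (h : IsSubadditiveCocycle T Φ C) (ν : Measure Ω)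
    [IsFiniteMeasure ν] : Integrable (fun ω => limsup (fun n : ℕ => Φ n ω / n) atTop) ν :=
  integrable_limsup (fun n => (h.continuous n).measurable.div_const _) (integrable_const C)
    h.abs_div_le

theorem asymptoticFreeEnergy_le_ksEntropy_add_integral_limsup (h : IsSubadditiveCocycle T Φ C)
    (hT : Measurable T) (hp : Measurable p) (ν : Measure Ω) [IsProbabilityMeasure ν] :
    (asymptoticFreeEnergy T p Φ ν : EReal) ≤ ksEntropy T ν +
      ((∫ ω, limsup (fun n : ℕ => Φ n ω / n) atTop ∂ν : ℝ) : EReal) := by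
  have hmeas (n : ℕ) : Measurable fun ω => Φ n ω / n := (h.continuous n).measurable.div_const _
  let tail (n : ℕ) : ℝ := ∫ ω, ⨆ k, Φ (n + k) ω / (n + k : ℕ) ∂ν
  have htail : Tendsto tail atTop (𝓝 (∫ ω, limsup (fun n : ℕ => Φ n ω / n) atTop ∂ν)) :=
    tendsto_integral_iSup_nat_add hmeas (integrable_const C) h.abs_div_le
  have hentropy (n : ℕ) (hn : 1 ≤ n) : asymptoticFreeEnergy T p Φ ν - tail n ≤
      partitionEntropy ν (itinerary T p n) / n := by
    have hle := h.asymptoticFreeEnergy_le_freeEnergy_div hT hp ν hn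
    have hint := integral_le_integral_iSup_nat_add hmeas (integrable_const C) h.abs_div_le n
      (μ := ν)
    rw [integral_div] at hint
    rw [freeEnergy, add_div] at hle
    exact sub_le_iff_le_add.2 (hle.trans (add_le_add_right hint _))
  have hlim := (continuous_coe_real_ereal.tendsto _).comp
    (htail.const_sub (asymptoticFreeEnergy T p Φ ν))
  have hks := limsup_partitionEntropy_itinerary_div_le_ksEntropy (T := T) hp ν
  rw [← EReal.sub_le_iff_le_add (.inl (EReal.coe_ne_bot _)) (.inl (EReal.coe_ne_top _)),
    ← EReal.coe_sub]
  refine (hlim.limsup_eq.symm.le.trans (limsup_le_limsup ?_)).trans hks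
  filter_upwards [eventually_ge_atTop 1] with n hn
  exact EReal.coe_le_coe_iff.2 (hentropy n hn)

end IsSubadditiveCocycle

theorem IsSubadditiveCocycle.limsup_log_sum_exp_div_le {Ω ι : Type*} [TopologicalSpace Ω]
    [CompactSpace Ω] [T2Space Ω] [MeasurableSpace Ω] [BorelSpace Ω] [HasOuterApproxClosed Ω]
    [Finite ι] [MeasurableSpace ι] [MeasurableSingletonClass ι] {T : Ω → Ω} {p : Ω → ι}
    {Φ : ℕ → Ω → ℝ} {C : ℝ} (h : IsSubadditiveCocycle T Φ C) (hT : Continuous T)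
    (hp : IsLocallyConstant p) {W : ℕ → Type*} [∀ n, Fintype (W n)] {x : ∀ n, W n → Ω}
    (hx : ∀ n, Function.Injective (itinerary T p n ∘ x n)) :
    limsup (fun n : ℕ =>
      ENNReal.log (ENNReal.ofReal (∑ w, Real.exp (Φ n (x n w)))) / (n : EReal)) atTop ≤
      ⨆ (ν : Measure Ω) (_ : IsProbabilityMeasure ν) (_ : Ergodic T ν),
        ksEntropy T ν + ((∫ ω, limsup (fun n : ℕ => Φ n ω / n) atTop ∂ν : ℝ) : EReal) := by
  let : Fintype ι := Fintype.ofFinite ι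
  have hTm := hT.measurable
  have hpm := measurable_of_isLocallyConstant hp
  refine EReal.ge_of_forall_gt_iff_ge.1 fun c hc => ?_
  have hfreq := (frequently_lt_of_lt_limsup (by isBoundedDefault) hc).and_eventually
    (eventually_ne_atTop 0)
  obtain ⟨ν₀, hν₀, hcν₀⟩ := h.exists_measurePreserving_le_asymptoticFreeEnergy hT hp
    (hfreq.mono fun n hn => h.exists_mul_le_freeEnergy hTm hpm hn.2 (hx n) hn.1)
  obtain ⟨ν, hν, hmax⟩ := exists_ergodic_forall_measurePreserving_le hT
    (h.upperSemicontinuous_asymptoticFreeEnergy hT hp)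
    (fun κ κ₁ κ₂ a b hab hκ₁ hκ₂ hκ =>
      hκ ▸ h.asymptoticFreeEnergy_add_measure_le hTm hpm hab hκ₁ hκ₂) hν₀
  have hprob : IsProbabilityMeasure (ν : Measure Ω) := inferInstance
  refine le_iSup_of_le (ν : Measure Ω) (le_iSup_of_le hprob (le_iSup_of_le hν ?_))
  exact (EReal.coe_le_coe_iff.2 (hcν₀.trans (hmax ν₀ hν₀))).trans
    (h.asymptoticFreeEnergy_le_ksEntropy_add_integral_limsup hTm hpm ν)

section FiberMax

variable {Ω X : Type*} {R : Ω × X → Ω × X} {f : Ω × X → ℝ} {C : ℝ}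

/-- The supremum over the fibre `{ω} × X` of the Birkhoff sums of `f` along `R`; when `X` is empty
it is the junk value `0`. -/
noncomputable def fiberMaxBirkhoffSum (R : Ω × X → Ω × X) (f : Ω × X → ℝ) (n : ℕ) (ω : Ω) : ℝ :=
  ⨆ t, birkhoffSum R f n (ω, t)

theorem abs_birkhoffSum_le {α : Type*} {g : α → α} {u : α → ℝ} (hu : ∀ x, |u x| ≤ C) (n : ℕ)
    (x : α) : |birkhoffSum g u n x| ≤ C * n := by
  refine (Finset.abs_sum_le_sum_abs _ _).trans ((Finset.sum_le_sum fun k _ => hu _).trans_eq ?_)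
  rw [Finset.sum_const, Finset.card_range, nsmul_eq_mul, mul_comm]

theorem birkhoffSum_le_fiberMaxBirkhoffSum (hf : ∀ x, |f x| ≤ C) (n : ℕ) (x : Ω × X) :
    birkhoffSum R f n x ≤ fiberMaxBirkhoffSum R f n x.1 := by
  have hbdd : BddAbove (Set.range fun t => birkhoffSum R f n (x.1, t)) :=
    ⟨C * n, Set.forall_mem_range.2 fun t => (abs_le.1 (abs_birkhoffSum_le hf n _)).2⟩
  exact le_ciSup hbdd x.2

theorem fiberMaxBirkhoffSum_add_le [Nonempty X] {T : Ω → Ω} (hRT : Function.Semiconj Prod.fst R T)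
    (hf : ∀ x, |f x| ≤ C) (m n : ℕ) (ω : Ω) :
    fiberMaxBirkhoffSum R f (m + n) ω ≤
      fiberMaxBirkhoffSum R f m ω + fiberMaxBirkhoffSum R f n (T^[m] ω) := by
  refine ciSup_le fun t => ?_
  rw [birkhoffSum_add, ← (hRT.iterate_right m (ω, t) : (R^[m] (ω, t)).1 = T^[m] ω)]
  exact add_le_add (birkhoffSum_le_fiberMaxBirkhoffSum hf m (ω, t))
    (birkhoffSum_le_fiberMaxBirkhoffSum hf n _)

variable [TopologicalSpace Ω] [TopologicalSpace X] [CompactSpace X]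

theorem continuous_fiberMaxBirkhoffSum (hR : Continuous R) (hf : Continuous f) (n : ℕ) :
    Continuous (fiberMaxBirkhoffSum R f n) := by
  have hsum : Continuous (birkhoffSum R f n) :=
    continuous_finsetSum _ fun k _ => hf.comp (hR.iterate k)
  have hsup : Continuous fun ω => sSup ((fun t => birkhoffSum R f n (ω, t)) '' Set.univ) :=
    isCompact_univ.continuous_sSup hsum
  simpa only [fiberMaxBirkhoffSum, iSup, Set.image_univ] using! hsup

theorem isSubadditiveCocycle_fiberMaxBirkhoffSum [Nonempty X] {T : Ω → Ω} (hR : Continuous R)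
    (hRT : Function.Semiconj Prod.fst R T) (hf : Continuous f) (hfC : ∀ x, |f x| ≤ C) :
    IsSubadditiveCocycle T (fiberMaxBirkhoffSum R f) C where
  continuous := continuous_fiberMaxBirkhoffSum hR hf
  add_le := fiberMaxBirkhoffSum_add_le hRT hfC
  abs_le n _ := abs_iSup_le fun _ => abs_birkhoffSum_le hfC n _

end FiberMax

section SkewProduct

variable {S : Type*} {A : S → S → Prop} {X : Type*} {F : MarkovShift A → X → X}
  {φ : X → MarkovShift A → ℝ}

theorem skewProduct_iterate (k : ℕ) (ω : MarkovShift A) (t : X) :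
    (skewProduct F)^[k] (ω, t) = (MarkovShift.shift^[k] ω, fiberIter F k ω t) := by
  induction k with
  | zero => rfl
  | succ k ih =>
    rw [Function.iterate_succ_apply', ih, Function.iterate_succ_apply']
    rfl

variable (F φ) in
theorem maxInstability_eq_limsup_fiberMaxBirkhoffSum_div (ω : MarkovShift A) :
    maxInstability F φ ω = limsup (fun n : ℕ =>
      fiberMaxBirkhoffSum (skewProduct F) (jointPotential φ) n ω / n) atTop := by
  refine congrArg (limsup · atTop) (funext fun n => ?_)
  rw [← Real.mul_iSup_of_nonneg (by positivity), one_div, ← div_eq_inv_mul]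
  rfl

variable [Finite S] {C : ℝ}

theorem partitionSum_le_sum_exp_fiberMaxBirkhoffSum (hφ : ∀ t ω, |φ t ω| ≤ C)
    (ωa : MarkovShift A) (n : ℕ) (t : X) :
    partitionSum F φ ωa n t ≤ ∑ w : MarkovShift.WordTo A n (ωa.seq 0),
      Real.exp (fiberMaxBirkhoffSum (skewProduct F) (jointPotential φ) n (ωa.glue w)) := by
  refine Finset.sum_le_sum fun w _ => Real.exp_le_exp.2 ?_
  have hle := birkhoffSum_le_fiberMaxBirkhoffSum (R := skewProduct F) (f := jointPotential φ)
    (fun x => hφ x.2 x.1) n (ωa.glue w, t)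
  simpa only [birkhoffSum, skewProduct_iterate, jointPotential] using hle

theorem pressure_le_limsup_log_sum_exp_fiberMaxBirkhoffSum_div (hφ : ∀ t ω, |φ t ω| ≤ C)
    (ωa : MarkovShift A) :
    pressure F φ ωa ≤ limsup (fun n : ℕ => ENNReal.log (ENNReal.ofReal
      (∑ w : MarkovShift.WordTo A n (ωa.seq 0), Real.exp (fiberMaxBirkhoffSum (skewProduct F)
        (jointPotential φ) n (ωa.glue w)))) / (n : EReal)) atTop :=
  limsup_le_limsup (Eventually.of_forall fun n => EReal.div_le_div_right_of_nonneg (by positivity)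
    (ENNReal.log_monotone (iSup_le fun t => ENNReal.ofReal_le_ofReal
      (partitionSum_le_sum_exp_fiberMaxBirkhoffSum hφ ωa n t))))

end SkewProduct

namespace MarkovShift

variable {S : Type*} {A : S → S → Prop}

theorem isInducing_seq [TopologicalSpace S] [DiscreteTopology S] :
    Topology.IsInducing (seq : MarkovShift A → ℕ → S) := by
  obtain rfl : ‹TopologicalSpace S› = ⊥ := DiscreteTopology.eq_bot
  let : TopologicalSpace S := ⊥
  exact ⟨rfl⟩

theorem range_seq : Set.range (seq : MarkovShift A → ℕ → S) = {f | ∀ i, A (f i) (f (i + 1))} :=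
  Set.ext fun f => ⟨fun ⟨ω, hω⟩ => hω ▸ ω.adm, fun hf => ⟨⟨f, hf⟩, rfl⟩⟩

theorem isClosedEmbedding_seq [TopologicalSpace S] [DiscreteTopology S] :
    Topology.IsClosedEmbedding (seq : MarkovShift A → ℕ → S) := by
  refine ⟨⟨isInducing_seq, seq_injective⟩, ?_⟩
  rw [range_seq, Set.ofPred_forall]
  exact isClosed_iInter fun i => (isClosed_discrete {x : S × S | A x.1 x.2}).preimage
    (f := fun f : ℕ → S => (f i, f (i + 1)))
    ((continuous_apply i).prodMk (continuous_apply (i + 1)))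

instance [Finite S] : CompactSpace (MarkovShift A) := by
  let : TopologicalSpace S := ⊥
  have : DiscreteTopology S := ⟨rfl⟩
  exact isClosedEmbedding_seq.compactSpace

theorem isLocallyConstant_seq_apply (i : ℕ) :
    IsLocallyConstant fun ω : MarkovShift A => ω.seq i := by
  let : TopologicalSpace S := ⊥
  have : DiscreteTopology S := ⟨rfl⟩
  exact (IsLocallyConstant.iff_continuous _).2
    ((continuous_apply i).comp isInducing_seq.continuous)

theorem continuous_shift : Continuous (shift : MarkovShift A → MarkovShift A) := by
  let : TopologicalSpace S := ⊥
  have : DiscreteTopology S := ⟨rfl⟩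
  exact isInducing_seq.continuous_iff.2
    (continuous_pi fun i => (isLocallyConstant_seq_apply (i + 1)).continuous)

theorem seq_shift_iterate (ω : MarkovShift A) (k i : ℕ) :
    (shift^[k] ω).seq i = ω.seq (i + k) := by
  induction k generalizing ω with
  | zero => rfl
  | succ k ih =>
    rw [Function.iterate_succ_apply, ih]
    simp only [shift, add_assoc]

theorem itinerary_glue {n : ℕ} (ωa : MarkovShift A) (w : WordTo A n (ωa.seq 0)) :
    itinerary shift (fun ω : MarkovShift A => ω.seq 0) n (ωa.glue w) = w.1 := by
  funext j
  simp only [itinerary, seq_shift_iterate, zero_add, glue, j.isLt, dif_pos]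

theorem injective_itinerary_glue {n : ℕ} (ωa : MarkovShift A) :
    Function.Injective (itinerary shift (fun ω : MarkovShift A => ω.seq 0) n ∘
      (ωa.glue : WordTo A n (ωa.seq 0) → MarkovShift A)) := fun w w' hww =>
  Subtype.ext (by simpa only [Function.comp_apply, itinerary_glue] using hww)

end MarkovShift

theorem continuous_uncurry_of_holderWith {Y Z E : Type*} [PseudoMetricSpace Y]
    [TopologicalSpace Z] [PseudoMetricSpace E] {f : Y → Z → E} {C β : ℝ≥0} (hβ : 0 < β)
    (hf : ∀ z, HolderWith C β fun y => f y z) (hc : ∀ y, Continuous (f y)) :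
    Continuous fun x : Y × Z => f x.1 x.2 := by
  refine continuous_iff_continuousAt.2 fun ⟨y₀, z₀⟩ => tendsto_iff_dist_tendsto_zero.2 ?_
  have hbound : Tendsto (fun x : Y × Z => (C : ℝ) * dist x.1 y₀ ^ (β : ℝ) +
      dist (f y₀ x.2) (f y₀ z₀)) (𝓝 (y₀, z₀)) (𝓝 0) := by
    have hcont : Continuous fun x : Y × Z => (C : ℝ) * dist x.1 y₀ ^ (β : ℝ) +
        dist (f y₀ x.2) (f y₀ z₀) :=
      (continuous_const.mul ((continuous_fst.dist continuous_const).rpow_const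
        fun _ => Or.inr β.coe_nonneg)).add (((hc y₀).comp continuous_snd).dist continuous_const)
    simpa [Real.zero_rpow (NNReal.coe_pos.2 hβ).ne'] using hcont.tendsto (y₀, z₀)
  refine squeeze_zero (fun _ => dist_nonneg) (fun x => ?_) hbound
  exact (dist_triangle _ (f y₀ x.2) _).trans (add_le_add_left ((hf x.2).dist_le x.1 y₀) _)

end POE

theorem mainTheorem6_general {S : Type*} [Finite S] {A : S → S → Prop}
    {X : Type*} [TopologicalSpace X] [CompactSpace X] [Nonempty X]
    {F : POE.MarkovShift A → X → X} (hF : Continuous fun x : POE.MarkovShift A × X => F x.1 x.2)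
    {φ : X → POE.MarkovShift A → ℝ}
    (hφ : Continuous fun x : POE.MarkovShift A × X => φ x.2 x.1) (ωa : POE.MarkovShift A) :
    (∀ ν : Measure (POE.MarkovShift A), IsFiniteMeasure ν →
        Integrable (POE.maxInstability F φ) ν) ∧
    POE.pressure F φ ωa ≤
      ⨆ (ν : Measure (POE.MarkovShift A)) (_ : IsProbabilityMeasure ν)
        (_ : Ergodic POE.MarkovShift.shift ν),
        POE.ksEntropy POE.MarkovShift.shift ν +
          ((∫ ω, POE.maxInstability F φ ω ∂ν : ℝ) : EReal) := by
  let : MeasurableSpace S := ⊤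
  obtain ⟨C, hC⟩ : ∃ C, ∀ x, |POE.jointPotential φ x| ≤ C :=
    ⟨_, ContinuousMap.norm_coe_le_norm ⟨POE.jointPotential φ, hφ⟩⟩
  have hcocycle : POE.IsSubadditiveCocycle POE.MarkovShift.shift
      (POE.fiberMaxBirkhoffSum (POE.skewProduct F) (POE.jointPotential φ)) C :=
    POE.isSubadditiveCocycle_fiberMaxBirkhoffSum
      ((POE.MarkovShift.continuous_shift.comp continuous_fst).prodMk hF) (fun _ => rfl) hφ hC
  rw [funext (POE.maxInstability_eq_limsup_fiberMaxBirkhoffSum_div F φ)]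
  exact ⟨fun ν _ => hcocycle.integrable_limsup_div ν,
    (POE.pressure_le_limsup_log_sum_exp_fiberMaxBirkhoffSum_div (fun t ω => hC (ω, t)) ωa).trans
      (hcocycle.limsup_log_sum_exp_div_le POE.MarkovShift.continuous_shift
        (POE.MarkovShift.isLocallyConstant_seq_apply 0)
        fun _ => POE.MarkovShift.injective_itinerary_glue ωa)⟩

theorem mainTheorem6 {S : Type*} [Finite S] (A : S → S → Prop)
    {X : Type*} [MetricSpace X] [CompactSpace X] [Nonempty X]
    (F : POE.MarkovShift A → X ≃ₜ X)
    (hF : ∃ α : ℝ≥0, 0 < α ∧ ∀ ω, ∃ C : ℝ≥0, HolderWith C α (F ω))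
    (hFω : ∃ C β : ℝ≥0, 0 < β ∧ ∀ t, HolderWith C β (fun ω => F ω t))
    (φ : X → POE.MarkovShift A → ℝ)
    (hφ : ∃ C β : ℝ≥0, 0 < β ∧ ∀ t, HolderWith C β (φ t) ∧ ∀ ω, |φ t ω| ≤ C)
    (hφt : ∀ ω, Continuous fun t => φ t ω)
    (ωa : POE.MarkovShift A) :
    (∀ ν : Measure (POE.MarkovShift A), IsProbabilityMeasure ν →
        Ergodic POE.MarkovShift.shift ν →
        Integrable (POE.maxInstability (fun ω => F ω) φ) ν) ∧
    POE.pressure (fun ω => F ω) φ ωa ≤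
      ⨆ (ν : Measure (POE.MarkovShift A)) (_ : IsProbabilityMeasure ν)
        (_ : Ergodic POE.MarkovShift.shift ν),
        POE.ksEntropy POE.MarkovShift.shift ν +
          ((∫ ω, POE.maxInstability (fun ω => F ω) φ ω ∂ν : ℝ) : EReal) := by
  obtain ⟨_, _, hβF, hFω⟩ := hFω
  obtain ⟨_, _, hβφ, hφ⟩ := hφ
  have hFcont := POE.continuous_uncurry_of_holderWith hβF hFω fun ω => (F ω).continuous
  have hφcont := POE.continuous_uncurry_of_holderWith hβφ (fun t => (hφ t).1) hφt
  have hgeneral := mainTheorem6_general (F := fun ω => F ω) hFcont hφcont ωa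
  exact ⟨fun ν _ _ => hgeneral.1 ν inferInstance, hgeneral.2⟩
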